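/- A partition of a positive integer $n$ is written $\lambda=(\lambda_1\ge\lambda_2\ge\cdots\ge\lambda_t)$ with positive integer parts summing to $n$. Its mex is the smallest positive integer that is not a part of $\lambda$. The partition has a fixed point if $\lambda_i=i$ for some index $i$ with $1\le i\le t$. Let $\omega(\lambda)$ be the number of parts of $\lambda$ equal to $1$ and $\mu(\lambda)$ the number of parts greater than $\omega(\lambda)$; the crank of $\lambda$ is $\lambda_1$ if $\omega(\lambda)=0$, and $\mu(\lambda)-\omega(\lambda)$ if $\omega(\lambda)>0$. Let $x_e(n,k)$, $f(n,k)$, $m_{<0}(n,k)$ and $m_{>0}(n,k)$ denote the numbers of partitions of $n$ with exactly $k$ parts greater than $1$ that have, respectively, even mex, a fixed point, negative crank, and positive crank. Theorem. For all positive integers $n$ and $k$, $$x_e(n,k)=f(n,k+1)=m_{<0}(n,k)=m_{>0}(n,k+1).$$ That is, the following are equinumerous: (a) partitions of $n$ with even mex and $k$ parts greater than $1$; (b) partitions of $n$ with a fixed point and $k+1$ parts greater than $1$; (c) partitions of $n$ with negative crank and $k$ parts greater than $1$; (d) partitions of $n$ with positive crank and $k+1$ parts greater than $1$. -/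

import Mathlib

namespace PartitionStat

/-- The parts of `p` listed in nonincreasing order. -/
def partList {n : ℕ} (p : Nat.Partition n) : List ℕ := p.parts.sort (· ≥ ·)

/-- The number of parts equal to 1. -/
def numOnes {n : ℕ} (p : Nat.Partition n) : ℕ := p.parts.count 1

/-- The number of parts greater than `m`. -/
def numPartsGT {n : ℕ} (p : Nat.Partition n) (m : ℕ) : ℕ := p.parts.countP (fun a => m < a)

/-- The largest part (0 for the empty partition). -/
def largestPart {n : ℕ} (p : Nat.Partition n) : ℕ := p.parts.sup

/-- The crank: the largest part if there are no ones; otherwise the number of parts greater than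
the number of ones, minus the number of ones. -/
def crank {n : ℕ} (p : Nat.Partition n) : ℤ :=
  if numOnes p = 0 then (largestPart p : ℤ)
  else (numPartsGT p (numOnes p) : ℤ) - (numOnes p : ℤ)

theorem exists_pos_notMem {n : ℕ} (p : Nat.Partition n) : ∃ m : ℕ, 0 < m ∧ m ∉ p.parts :=
  ⟨n + 1, n.succ_pos, fun h => absurd (Nat.Partition.le_of_mem_parts h) (by omega)⟩

/-- The minimal excludant: the smallest positive integer that is not a part. -/
def mex {n : ℕ} (p : Nat.Partition n) : ℕ := Nat.find (exists_pos_notMem p)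

/-- `p = (p₁ ≥ p₂ ≥ ⋯ ≥ pₜ)` has `pᵢ = i` for some `i`; list positions start at 0. -/
def HasFixedPoint {n : ℕ} (p : Nat.Partition n) : Prop :=
  ∃ i : ℕ, (partList p)[i]? = some (i + 1)

/-- Partitions of `n` with even mex and exactly `k` parts greater than 1. -/
def evenMex (n k : ℕ) : Set (Nat.Partition n) :=
  {p | Even (mex p) ∧ numPartsGT p 1 = k}

/-- Partitions of `n` with a fixed point and exactly `k` parts greater than 1. -/
def fixedPt (n k : ℕ) : Set (Nat.Partition n) :=
  {p | HasFixedPoint p ∧ numPartsGT p 1 = k}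

/-- Partitions of `n` with negative crank and exactly `k` parts greater than 1. -/
def negCrank (n k : ℕ) : Set (Nat.Partition n) :=
  {p | crank p < 0 ∧ numPartsGT p 1 = k}

/-- Partitions of `n` with positive crank and exactly `k` parts greater than 1. -/
def posCrank (n k : ℕ) : Set (Nat.Partition n) :=
  {p | 0 < crank p ∧ numPartsGT p 1 = k}

end PartitionStat

/-!
Erasing the ones, a partition of `n` with `k` parts greater than `1` becomes a multiset of `k` parts
`≥ 2` with sum at most `n` (`bigParts n k`), from which the number `ω` of ones is recovered. Each
such multiset splits uniquely as `A + B` along its Durfee rectangle of excess `a`: with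
`d = card A`, the parts in `A` are at least `d + a` and those in `B` at most `d + a`. In terms of
these splittings,

* the crank is positive iff `ω < d` for `a = 0`, i.e. iff the splitting is not in `manyOnes 0`;
* the crank is negative iff `ω - 1 ≥ d` for `a = 1`, i.e. iff the splitting is in
  `manyOnes 1 (n - 1)`;
* if `k ≥ 2`, there is a fixed point iff `d ∈ A` for `a = 0`, i.e. iff the splitting is in
  `cornerSplits 0`.

Two bijections link these sets. Trading `d` ones for an increase of each part of `A` by `1` maps
`manyOnes a` onto the complement of `cornerSplits a` (`image_manyOnes`). Adding a corner part
maps `manyOnes (a + 1) n k` onto `cornerSplits a (n + a + 1) (k + 1)` (`image_manyOnes_succ`).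
For `a = 0` they give (fixed point) = (positive crank) and (fixed point) = (negative crank). For
`a ≥ 1` they together give a recursion which determines the cardinality of `manyOnes a n k`.

Finally, the mex is even iff `1` is a part and the run of consecutive parts `2, 3, …` has even
length. Deleting the first element of an odd run `a + 1, a + 2, …` leaves an even run from `a + 2`,
which yields the same recursion for multisets with an even run (`evenRuns_succ_add`); hence `evenRuns a`
and `manyOnes a` are equinumerous for `a ≥ 1` (`ncard_evenRuns`), and `a = 1` is the equality
between even mex and negative crank.
-/

namespace PartitionStat

open Multiset

/-- The multisets of `k` parts, all at least `2`, with sum at most `n`. They encode the partitions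
of `n` with `k` parts greater than `1`: the missing `n - s.sum` is made up by ones. -/
def bigParts (n k : ℕ) : Set (Multiset ℕ) :=
  {s | (∀ x ∈ s, 2 ≤ x) ∧ card s = k ∧ s.sum ≤ n}

/-! ### Partitions as multisets of parts greater than one -/

theorem parts_eq {n : ℕ} (p : Nat.Partition n) :
    p.parts = p.parts.filter (fun a => 1 < a) + replicate (numOnes p) 1 := by
  conv_lhs => rw [← filter_add_not (fun a => 1 < a) p.parts]
  congr 1
  rw [numOnes, ← filter_eq']
  refine filter_congr fun x hx => ?_
  have := p.parts_pos hx
  omega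

theorem sum_filter_add_numOnes {n : ℕ} (p : Nat.Partition n) :
    (p.parts.filter (fun a => 1 < a)).sum + numOnes p = n := by
  have h := congrArg Multiset.sum (parts_eq p)
  simpa [p.parts_sum, eq_comm] using h

theorem filter_mem_bigParts {n k : ℕ} {p : Nat.Partition n} (h : numPartsGT p 1 = k) :
    p.parts.filter (fun a => 1 < a) ∈ bigParts n k :=
  ⟨fun _ hx => (mem_filter.1 hx).2, by rw [← h, numPartsGT, countP_eq_card_filter],
    by have := sum_filter_add_numOnes p; omega⟩

theorem exists_partition_filter_eq {n k : ℕ} {s : Multiset ℕ} (hs : s ∈ bigParts n k) :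
    ∃ p : Nat.Partition n, p.parts.filter (fun a => 1 < a) = s := by
  obtain ⟨h2, -, hs⟩ := hs
  refine ⟨⟨s + replicate (n - s.sum) 1, ?_, by simp; omega⟩, ?_⟩
  · intro i hi
    rcases mem_add.1 hi with hi | hi
    · have := h2 i hi; omega
    · rw [eq_of_mem_replicate hi]; omega
  · have h1 : s.filter (fun a => 1 < a) = s := filter_eq_self.2 h2
    rw [filter_add, h1, filter_eq_nil.2, add_zero]
    intro x hx
    rw [eq_of_mem_replicate hx]; omega

/-- To count partitions by a property is to count multisets in `bigParts` by the corresponding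
property. -/
theorem ncard_partitions {n k : ℕ} {Q : Nat.Partition n → Prop} {R : Multiset ℕ → Prop}
    (h : ∀ p, numPartsGT p 1 = k → (Q p ↔ R (p.parts.filter (fun a => 1 < a)))) :
    {p : Nat.Partition n | Q p ∧ numPartsGT p 1 = k}.ncard
      = {s | s ∈ bigParts n k ∧ R s}.ncard := by
  refine Set.ncard_congr (fun p _ => p.parts.filter (fun a => 1 < a)) ?_ ?_ ?_
  · rintro p ⟨hQ, hk⟩
    exact ⟨filter_mem_bigParts hk, (h p hk).1 hQ⟩
  · intro p q _ _ hpq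
    have h1 := sum_filter_add_numOnes p
    have h2 := sum_filter_add_numOnes q
    rw [hpq] at h1
    apply Nat.Partition.ext
    rw [parts_eq p, parts_eq q, hpq, show numOnes p = numOnes q by omega]
  · rintro s ⟨hs, hR⟩
    obtain ⟨p, rfl⟩ := exists_partition_filter_eq hs
    have hk : numPartsGT p 1 = k := by
      rw [numPartsGT, countP_eq_card_filter, hs.2.1]
    exact ⟨p, ⟨(h p hk).2 hR, hk⟩, rfl⟩

theorem finite_bigParts (n k : ℕ) : (bigParts n k).Finite :=
  (Set.finite_range fun p : Nat.Partition n => p.parts.filter (fun a => 1 < a)).subset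
    fun _ hs => exists_partition_filter_eq hs

theorem countP_le_eq_countP_lt_add_count (m : ℕ) (s : Multiset ℕ) :
    countP (fun z => m ≤ z) s = countP (fun z => m < z) s + count m s := by
  induction s using Multiset.induction_on with
  | empty => simp
  | cons x s ih =>
    simp only [countP_cons, count_cons, ih]
    split_ifs <;> omega

/-! ### Durfee rectangles -/

/-- `A` consists of the first `d` parts of `A + B`, where `d × (d + a)` is the Durfee rectangle of
`A + B`: all of `A` is at least `d + a` and all of `B` is at most `d + a`, with `d = card A`. -/
def IsDurfeeSplit (a : ℕ) (x : Multiset ℕ × Multiset ℕ) : Prop :=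
  (∀ y ∈ x.1, card x.1 + a ≤ y) ∧ ∀ y ∈ x.2, y ≤ card x.1 + a

theorem IsDurfeeSplit.card_le {a : ℕ} {x y : Multiset ℕ × Multiset ℕ} (hx : IsDurfeeSplit a x)
    (hy : IsDurfeeSplit a y) (h : x.1 + x.2 = y.1 + y.2) : card y.1 ≤ card x.1 := by
  by_contra! hlt
  have h1 : countP (fun z => card x.1 + a < z) (x.1 + x.2) ≤ card x.1 := by
    rw [countP_add, (countP_eq_zero (s := x.2)).2 fun z hz => not_lt.2 (hx.2 z hz)]
    exact countP_le_card _ _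
  have h2 : countP (fun z => card x.1 + a < z) y.1 = card y.1 :=
    countP_eq_card.2 fun z hz => by have := hy.1 z hz; omega
  rw [h, countP_add] at h1
  omega

/-- The Durfee splitting of a multiset is unique. -/
theorem IsDurfeeSplit.eq {a : ℕ} {x y : Multiset ℕ × Multiset ℕ} (hx : IsDurfeeSplit a x)
    (hy : IsDurfeeSplit a y) (h : x.1 + x.2 = y.1 + y.2) : x = y := by
  have hd : card x.1 = card y.1 := le_antisymm (hy.card_le hx h.symm) (hx.card_le hy h)
  obtain ⟨A, B⟩ := x
  obtain ⟨A', B'⟩ := y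
  obtain ⟨hA, hB⟩ := hx
  obtain ⟨hA', hB'⟩ := hy
  simp only at *
  have hne : A.filter (fun z => ¬ z = card A + a) = A'.filter (fun z => ¬ z = card A + a) := by
    ext z
    by_cases hz : z = card A + a
    · rw [count_filter, count_filter, if_neg (not_not.2 hz), if_neg (not_not.2 hz)]
    · rw [count_filter, count_filter, if_pos hz, if_pos hz]
      rcases lt_or_gt_of_ne hz with hz | hz
      · have h1 : z ∉ A := fun hm => by have := hA z hm; omega
        have h2 : z ∉ A' := fun hm => by have := hA' z hm; omega
        rw [count_eq_zero.2 h1, count_eq_zero.2 h2]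
      · have h1 : z ∉ B := fun hm => by have := hB z hm; omega
        have h2 : z ∉ B' := fun hm => by have := hB' z hm; omega
        have := congrArg (count z) h
        rwa [count_add, count_add, count_eq_zero.2 h1, count_eq_zero.2 h2] at this
  -- `A` and `A'` agree away from `card A + a`; as their cardinalities agree, so do the
  -- multiplicities of `card A + a`.
  have hAA : A = A' := by
    have e1 := filter_add_not (fun z => z = card A + a) A
    have e2 := filter_add_not (fun z => z = card A + a) A'
    have c1 := congrArg card e1
    have c2 := congrArg card e2
    rw [filter_eq', card_add, card_replicate] at c1 c2
    rw [filter_eq'] at e1 e2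
    rw [← e1, ← e2, ← hne]
    congr 2
    rw [← hne] at c2
    omega
  subst hAA
  rw [add_left_cancel h]

theorem exists_isDurfeeSplit (a : ℕ) (s : Multiset ℕ) :
    ∃ x, IsDurfeeSplit a x ∧ x.1 + x.2 = s := by
  -- With `d` least such that at most `d` parts exceed `d + a`, at least `d` parts are `≥ d + a`.
  have hex : ∃ d, countP (fun z => d + a < z) s ≤ d := ⟨card s, countP_le_card _ _⟩
  set d := Nat.find hex with hd
  set c := countP (fun z => d + a < z) s with hc
  have hcd : c ≤ d := Nat.find_spec hex
  have hcount : d ≤ c + count (d + a) s := by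
    rcases Nat.eq_zero_or_pos d with h0 | h0
    · omega
    have hmin := Nat.find_min hex (m := d - 1) (by omega)
    have hsplit : countP (fun z => d - 1 + a < z) s = c + count (d + a) s := by
      rw [hc, ← countP_le_eq_countP_lt_add_count]
      refine countP_congr rfl fun x _ => ?_
      simp only [eq_iff_iff]
      omega
    omega
  set A := s.filter (fun z => d + a < z) + replicate (d - c) (d + a) with hA
  have hAs : A ≤ s := by
    rw [le_iff_count]
    intro z
    rw [hA, count_add, count_filter, count_replicate]
    split_ifs <;> first | omega | skip
    subst_vars
    omega
  have hAd : card A = d := by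
    rw [hA, card_add, card_replicate, ← countP_eq_card_filter]; omega
  refine ⟨(A, s - A), ⟨?_, ?_⟩, by simp [hAs]⟩
  · intro y hy
    simp only [hAd]
    rcases mem_add.1 hy with hy | hy
    · exact (mem_filter.1 hy).2.le
    · exact (eq_of_mem_replicate hy).ge
  · intro y hy
    simp only [hAd]
    by_contra! hlt
    have : 0 < count y (s - A) := count_pos.2 hy
    rw [count_sub, hA, count_add, count_filter_of_pos hlt] at this
    omega

/-- Durfee splittings of the multisets in `bigParts n k`. -/
def splits (a n k : ℕ) : Set (Multiset ℕ × Multiset ℕ) :=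
  {x | IsDurfeeSplit a x ∧ x.1 + x.2 ∈ bigParts n k}

theorem ncard_splits_and (a n k : ℕ) (R : Multiset ℕ → Prop) :
    {x | x ∈ splits a n k ∧ R (x.1 + x.2)}.ncard = {s | s ∈ bigParts n k ∧ R s}.ncard := by
  refine Set.ncard_congr (fun x _ => x.1 + x.2) ?_ ?_ ?_
  · rintro x ⟨⟨-, h⟩, hR⟩
    exact ⟨h, hR⟩
  · rintro x y ⟨⟨hx, -⟩, -⟩ ⟨⟨hy, -⟩, -⟩ h
    exact hx.eq hy h
  · rintro s ⟨h, hR⟩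
    obtain ⟨x, hx, rfl⟩ := exists_isDurfeeSplit a s
    exact ⟨x, ⟨⟨hx, h⟩, hR⟩, rfl⟩

theorem finite_splits (a n k : ℕ) : (splits a n k).Finite := by
  refine Set.Finite.of_finite_image (f := fun x => x.1 + x.2)
    ((finite_bigParts n k).subset ?_) ?_
  · rintro _ ⟨x, hx, rfl⟩
    exact hx.2
  · intro x hx y hy h
    exact hx.1.eq hy.1 h

/-- Splittings for which the number of ones is at least the height of the Durfee rectangle. -/
def manyOnes (a n k : ℕ) : Set (Multiset ℕ × Multiset ℕ) :=
  {x | x ∈ splits a n k ∧ x.1.sum + x.2.sum + card x.1 ≤ n}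

/-- Splittings whose `d`-th part equals `d + a`, where `d` is the height of the Durfee rectangle;
`a = 0` and `k ≥ 2` give the partitions with a fixed point. -/
def cornerSplits (a n k : ℕ) : Set (Multiset ℕ × Multiset ℕ) :=
  {x | x ∈ splits a n k ∧ card x.1 + a ∈ x.1}

/-- Adding `1` to each of the first `d` parts, at the cost of `d` ones, keeps the height `d` of the
Durfee rectangle and makes all of the first `d` parts exceed `d + a`; every splitting with that
property arises so. The hypothesis on `a` and `k` keeps the inverse map from producing a part `1`,
which happens for the single part `2` with `a = 0`. -/
theorem image_manyOnes (a n k : ℕ) (h : 1 ≤ a ∨ 2 ≤ k) :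
    (fun x : Multiset ℕ × Multiset ℕ => (x.1.map (· + 1), x.2)) '' manyOnes a n k
      = splits a n k \ cornerSplits a n k := by
  ext ⟨A, B⟩
  constructor
  · rintro ⟨⟨A, B⟩, ⟨⟨⟨hA, hB⟩, h2, hk, hs⟩, hm⟩, he⟩
    simp only [Prod.mk.injEq] at he hA hB hm h2 hk
    obtain ⟨rfl, rfl⟩ := he
    have hsum : (A.map (· + 1)).sum = A.sum + card A := by simp
    refine ⟨⟨⟨?_, ?_⟩, ?_, ?_, ?_⟩, ?_⟩
    · intro y hy
      obtain ⟨z, hz, rfl⟩ := mem_map.1 hy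
      have := hA z hz
      simp only [card_map]; omega
    · simpa using hB
    · intro y hy
      rcases mem_add.1 hy with hy | hy
      · obtain ⟨z, hz, rfl⟩ := mem_map.1 hy
        have := h2 z (mem_add.2 (Or.inl hz))
        omega
      · exact h2 y (mem_add.2 (Or.inr hy))
    · simpa using hk
    · simp only [sum_add, hsum]; omega
    · rintro ⟨-, hc⟩
      obtain ⟨z, hz, hze⟩ := mem_map.1 hc
      have := hA z hz
      simp only [card_map] at hze
      omega
  · rintro ⟨⟨⟨hA, hB⟩, h2, hk, hs⟩, hc⟩
    have hc' : card A + a ∉ A := fun hm => hc ⟨⟨⟨hA, hB⟩, h2, hk, hs⟩, hm⟩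
    simp only at hA hB h2 hk
    have hA' : ∀ y ∈ A, card A + a < y := fun y hy =>
      lt_of_le_of_ne (hA y hy) fun e => hc' (e ▸ hy)
    have hlow : ∀ y ∈ A, 3 ≤ y := by
      intro y hy
      have h1 := hA' y hy
      have hpos : 0 < card A := card_pos_iff_exists_mem.2 ⟨y, hy⟩
      rcases h with h | h
      · omega
      by_contra! hlt
      -- the Durfee rectangle would be `1 × 1`, leaving no room for a part below it
      have hB0 : B = 0 := eq_zero_of_forall_notMem fun z hz => by
        have := hB z hz
        have := h2 z (mem_add.2 (Or.inr hz))
        omega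
      subst hB0
      simp only [add_zero] at hk
      omega
    have hmap : (A.map (· - 1)).map (· + 1) = A := by
      rw [map_map]
      conv_rhs => rw [← map_id A]
      refine map_congr rfl fun y hy => ?_
      have := hlow y hy
      simp only [Function.comp_apply, id]; omega
    have hsum : (A.map (· - 1)).sum + card A = A.sum := by
      conv_rhs => rw [← hmap]
      simp
    simp only [sum_add] at hs
    refine ⟨(A.map (· - 1), B), ⟨⟨⟨?_, ?_⟩, ?_, ?_, ?_⟩, ?_⟩, ?_⟩
    · intro y hy
      obtain ⟨z, hz, rfl⟩ := mem_map.1 hy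
      have := hA' z hz
      simp only [card_map]; omega
    · simpa using hB
    · intro y hy
      rcases mem_add.1 hy with hy | hy
      · obtain ⟨z, hz, rfl⟩ := mem_map.1 hy
        have := hlow z hz
        omega
      · exact h2 y (mem_add.2 (Or.inr hy))
    · simpa using hk
    · simp only [sum_add]; omega
    · simp only [card_map]; omega
    · simp only [hmap]

/-- Adding a part `d + a + 1` below a Durfee rectangle of shape `d × (d + a + 1)` gives a Durfee
rectangle of shape `(d + 1) × (d + 1 + a)` with that part in its corner. The new sum is at most
`n + a + 1` exactly if the old one is at most `n - d`. -/
theorem image_manyOnes_succ (a n k : ℕ) (h : 1 ≤ a ∨ 1 ≤ k) :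
    (fun x : Multiset ℕ × Multiset ℕ => ((card x.1 + a + 1) ::ₘ x.1, x.2)) ''
      manyOnes (a + 1) n k = cornerSplits a (n + a + 1) (k + 1) := by
  ext ⟨A, B⟩
  constructor
  · rintro ⟨⟨A, B⟩, ⟨⟨⟨hA, hB⟩, h2, hk, hs⟩, hm⟩, he⟩
    simp only [Prod.mk.injEq] at he hA hB hm h2 hk
    obtain ⟨rfl, rfl⟩ := he
    rw [card_add] at hk
    refine ⟨⟨⟨?_, ?_⟩, ?_, ?_, ?_⟩, ?_⟩
    · intro y hy
      simp only [card_cons]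
      rcases mem_cons.1 hy with rfl | hy
      · omega
      · have := hA y hy; omega
    · intro y hy
      have := hB y hy
      simp only [card_cons]; omega
    · simp only [cons_add]
      intro y hy
      rcases mem_cons.1 hy with rfl | hy
      · by_contra! hlt
        -- a new part `1` means `d = a = 0`, which leaves no parts at all
        have hB0 : B = 0 := eq_zero_of_forall_notMem fun z hz => by
          have := hB z hz
          have := h2 z (mem_add.2 (Or.inr hz))
          omega
        subst hB0
        simp only [card_zero] at hk
        omega
      · exact h2 y hy
    · simp only [cons_add, card_cons, card_add]; omega
    · simp only [cons_add, sum_cons, sum_add]; omega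
    · simp only [card_cons, mem_cons]; left; omega
  · rintro ⟨⟨⟨hA, hB⟩, h2, hk, hs⟩, hc⟩
    simp only at hA hB h2 hk hc
    obtain ⟨A', hA'⟩ := exists_cons_of_mem hc
    have hcard : card A = card A' + 1 := by
      have := congrArg card hA'
      rwa [card_cons] at this
    have hsum := congrArg Multiset.sum hA'
    rw [sum_cons] at hsum
    simp only [sum_add] at hs
    have hsub : ∀ y ∈ A', y ∈ A := fun y hy => by rw [hA']; exact mem_cons_of_mem hy
    rw [card_add] at hk
    refine ⟨(A', B), ⟨⟨⟨?_, ?_⟩, ?_, ?_, ?_⟩, ?_⟩, ?_⟩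
    · intro y hy
      have := hA y (hsub y hy)
      simp only; omega
    · intro y hy
      have := hB y hy
      simp only; omega
    · intro y hy
      rcases mem_add.1 hy with hy | hy
      · exact h2 y (mem_add.2 (Or.inl (hsub y hy)))
      · exact h2 y (mem_add.2 (Or.inr hy))
    · simp only [card_add]; omega
    · simp only [sum_add]; omega
    · simp only; omega
    · simp only [Prod.mk.injEq, and_true]
      rw [hA']
      congr 1
      omega

theorem ncard_splits_diff_cornerSplits (a n k : ℕ) (h : 1 ≤ a ∨ 2 ≤ k) :
    (splits a n k \ cornerSplits a n k).ncard = (manyOnes a n k).ncard := by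
  rw [← image_manyOnes a n k h]
  refine Set.ncard_image_of_injective _ ?_
  rintro ⟨A, B⟩ ⟨A', B'⟩ he
  simp only [Prod.mk.injEq] at he
  rw [map_injective (add_left_injective 1) he.1, he.2]

theorem ncard_cornerSplits (a n k : ℕ) (h : 1 ≤ a ∨ 1 ≤ k) :
    (cornerSplits a (n + a + 1) (k + 1)).ncard = (manyOnes (a + 1) n k).ncard := by
  rw [← image_manyOnes_succ a n k h]
  refine Set.ncard_image_of_injective _ ?_
  rintro ⟨A, B⟩ ⟨A', B'⟩ he
  simp only [Prod.mk.injEq] at he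
  have hc := congrArg card he.1
  simp only [card_cons, Nat.add_right_cancel_iff] at hc
  rw [hc, cons_inj_right] at he
  rw [he.1, he.2]

theorem ncard_splits (a n k : ℕ) : (splits a n k).ncard = (bigParts n k).ncard := by
  simpa using ncard_splits_and a n k fun _ => True

theorem manyOnes_add_cornerSplits (a n k : ℕ) (h : 1 ≤ a ∨ 2 ≤ k) :
    (manyOnes a n k).ncard + (cornerSplits a n k).ncard = (bigParts n k).ncard := by
  rw [← ncard_splits_diff_cornerSplits a n k h, ← ncard_splits a,
    Set.ncard_sdiff_add_ncard_of_subset (fun _ hx => hx.1) (finite_splits a n k)]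

theorem cornerSplits_eq_empty {a n k : ℕ} (h : n < a + 1 ∨ k = 0) : cornerSplits a n k = ∅ := by
  refine Set.eq_empty_of_forall_notMem ?_
  rintro ⟨A, B⟩ ⟨⟨-, -, hk, hs⟩, hc⟩
  simp only [card_add, sum_add] at hk hs hc
  have h1 := le_sum_of_mem hc
  have h2 : 0 < card A := card_pos_iff_exists_mem.2 ⟨_, hc⟩
  omega

/-! ### Runs of consecutive parts and the mex -/

/-- The maximal run `a + 1, a + 2, …` of consecutive parts of `s` has even length. -/
def EvenRun (a : ℕ) (s : Multiset ℕ) : Prop :=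
  ∃ r, Even r ∧ a + 1 + r ∉ s ∧ ∀ i < r, a + 1 + i ∈ s

theorem exists_run (a : ℕ) (s : Multiset ℕ) :
    ∃ r, a + 1 + r ∉ s ∧ ∀ i < r, a + 1 + i ∈ s := by
  have hex : ∃ r, a + 1 + r ∉ s := ⟨s.sum, fun h => by have := le_sum_of_mem h; omega⟩
  exact ⟨Nat.find hex, Nat.find_spec hex, fun i hi => not_not.1 (Nat.find_min hex hi)⟩

theorem run_unique {a r r' : ℕ} {s : Multiset ℕ} (h : a + 1 + r ∉ s) (h' : ∀ i < r, a + 1 + i ∈ s)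
    (g : a + 1 + r' ∉ s) (g' : ∀ i < r', a + 1 + i ∈ s) : r = r' := by
  rcases lt_trichotomy r r' with hlt | heq | hlt
  · exact absurd (g' _ hlt) h
  · exact heq
  · exact absurd (h' _ hlt) g

theorem evenRun_iff_of_run {a r : ℕ} {s : Multiset ℕ} (h : a + 1 + r ∉ s)
    (h' : ∀ i < r, a + 1 + i ∈ s) : EvenRun a s ↔ Even r :=
  ⟨fun ⟨_, he, g, g'⟩ => run_unique g g' h h' ▸ he, fun he => ⟨r, he, h, h'⟩⟩

/-- If the run from `a + 1` is odd, removing one copy of `a + 1` leaves an even run from `a + 2`,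
whether or not other copies of `a + 1` remain. -/
theorem not_evenRun_iff (a : ℕ) (s : Multiset ℕ) :
    ¬ EvenRun a s ↔ ∃ t, s = (a + 1) ::ₘ t ∧ EvenRun (a + 1) t := by
  obtain ⟨r, h, h'⟩ := exists_run a s
  rw [evenRun_iff_of_run h h', Nat.not_even_iff_odd]
  constructor
  · rintro ⟨m, rfl⟩
    obtain ⟨t, rfl⟩ := exists_cons_of_mem (h' 0 (by omega))
    refine ⟨t, rfl, 2 * m, even_two_mul m, fun hm => h (mem_cons_of_mem ?_), fun i hi => ?_⟩
    · convert hm using 1; omega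
    · have := (mem_cons.1 (h' (i + 1) (by omega))).resolve_left (by omega)
      convert this using 1; omega
  · rintro ⟨t, rfl, q, hq, g, g'⟩
    have : q + 1 = r := by
      refine run_unique (fun hm => ?_) (fun i hi => ?_) h h'
      · have := (mem_cons.1 hm).resolve_left (by omega)
        exact g (by convert this using 1; omega)
      · rcases i with _ | i
        · exact mem_cons_self _ _
        · refine mem_cons_of_mem ?_
          convert g' i (by omega) using 1; omega
    rw [← this]
    exact hq.add_one

/-- The multisets in `bigParts n k` whose run of parts starting at `a + 1` has even length. -/
def evenRuns (a n k : ℕ) : Set (Multiset ℕ) := {s | s ∈ bigParts n k ∧ EvenRun a s}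

theorem image_evenRuns (a n k : ℕ) (ha : 1 ≤ a) :
    (fun s => (a + 1) ::ₘ s) '' evenRuns (a + 1) n k
      = bigParts (n + a + 1) (k + 1) \ evenRuns a (n + a + 1) (k + 1) := by
  ext s
  constructor
  · rintro ⟨t, ⟨⟨h2, hk, hs⟩, hr⟩, rfl⟩
    refine ⟨⟨?_, by simp [hk], by simp only [sum_cons]; omega⟩, fun hn => ?_⟩
    · intro x hx
      rcases mem_cons.1 hx with rfl | hx
      · omega
      · exact h2 x hx
    · exact (not_evenRun_iff a _).2 ⟨t, rfl, hr⟩ hn.2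
  · rintro ⟨hb, hn⟩
    obtain ⟨t, rfl, hr⟩ := (not_evenRun_iff a s).1 fun he => hn ⟨hb, he⟩
    obtain ⟨h2, hk, hs⟩ := hb
    simp only [card_cons, sum_cons] at hk hs
    exact ⟨t, ⟨⟨fun x hx => h2 x (mem_cons_of_mem hx), by omega, by omega⟩, hr⟩, rfl⟩

theorem evenRuns_succ_add (a n k : ℕ) (ha : 1 ≤ a) :
    (evenRuns a (n + a + 1) (k + 1)).ncard + (evenRuns (a + 1) n k).ncard
      = (bigParts (n + a + 1) (k + 1)).ncard := by
  rw [← Set.ncard_sdiff_add_ncard_of_subset (t := bigParts (n + a + 1) (k + 1))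
    (s := evenRuns a (n + a + 1) (k + 1)) (fun _ hx => hx.1) (finite_bigParts _ _),
    ← image_evenRuns a n k ha,
    Set.ncard_image_of_injective _ (fun _ _ => (cons_inj_right (a + 1)).1),
    add_comm]

theorem evenRuns_eq_bigParts {a n k : ℕ} (h : n < a + 1 ∨ k = 0) :
    evenRuns a n k = bigParts n k := by
  refine Set.Subset.antisymm (fun _ hx => hx.1) fun s hb => ⟨hb, ?_⟩
  by_contra hn
  obtain ⟨t, rfl, -⟩ := (not_evenRun_iff a s).1 hn
  obtain ⟨-, hk, hs⟩ := hb
  simp only [card_cons, sum_cons] at hk hs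
  omega

/-- Both sides satisfy the recursion `Z a n k = #(bigParts n k) - Z (a + 1) (n - a - 1) (k - 1)`,
where the last term is absent if `n ≤ a` or `k = 0`. -/
theorem ncard_evenRuns (n : ℕ) : ∀ a k : ℕ, 1 ≤ a →
    (evenRuns a n k).ncard = (manyOnes a n k).ncard := by
  induction n using Nat.strong_induction_on with
  | _ n ih =>
    intro a k ha
    have h1 := manyOnes_add_cornerSplits a n k (Or.inl ha)
    by_cases hbase : n < a + 1 ∨ k = 0
    · rw [cornerSplits_eq_empty hbase, Set.ncard_empty] at h1
      rw [evenRuns_eq_bigParts hbase]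
      omega
    · push Not at hbase
      obtain ⟨m, rfl⟩ : ∃ m, n = m + a + 1 := ⟨n - a - 1, by omega⟩
      obtain ⟨j, rfl⟩ := Nat.exists_eq_succ_of_ne_zero hbase.2
      have h2 := evenRuns_succ_add a m j ha
      have h3 := ncard_cornerSplits a m j (Or.inl ha)
      have h4 := ih m (by omega) (a + 1) j (by omega)
      simp only [Nat.succ_eq_add_one] at *
      omega

/-! ### The four statistics -/

theorem mem_parts_iff {n x : ℕ} (p : Nat.Partition n) (hx : 1 < x) :
    x ∈ p.parts ↔ x ∈ p.parts.filter (fun a => 1 < a) := by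
  simp [mem_filter, hx]

theorem even_mex_iff {n : ℕ} (p : Nat.Partition n) :
    Even (mex p) ↔ 1 ∈ p.parts ∧ EvenRun 1 (p.parts.filter (fun a => 1 < a)) := by
  have hspec := Nat.find_spec (exists_pos_notMem p)
  have hmin : ∀ m, 0 < m → m < mex p → m ∈ p.parts := fun m h0 hm => by
    have := Nat.find_min (exists_pos_notMem p) hm
    simpa [h0] using this
  change 0 < mex p ∧ mex p ∉ p.parts at hspec
  by_cases h1 : 1 ∈ p.parts
  · have hge : 2 ≤ mex p := by
      by_contra! hlt
      have : mex p = 1 := by omega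
      exact hspec.2 (this ▸ h1)
    obtain ⟨r, hr⟩ : ∃ r, mex p = 1 + 1 + r := ⟨mex p - 2, by omega⟩
    rw [evenRun_iff_of_run (r := r), hr]
    · simp only [h1, true_and]
      rw [show 1 + 1 + r = r + 2 by omega, Nat.even_add]
      simp
    · rw [← mem_parts_iff p (by omega), ← hr]; exact hspec.2
    · intro i hi
      rw [← mem_parts_iff p (by omega)]
      exact hmin _ (by omega) (by omega)
  · have : mex p = 1 := by
      by_contra hne
      exact h1 (hmin 1 one_pos (by omega))
    simp [this, h1]

/-- The mex is even exactly if `1` is a part and the run of parts starting at `2` has even length.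
A partition of `n + 1` has `1` as a part exactly if its parts greater than `1` sum to at most
`n`. -/
theorem ncard_evenMex (n k : ℕ) : (evenMex (n + 1) k).ncard = (evenRuns 1 n k).ncard := by
  rw [evenMex, ncard_partitions (R := fun s => s.sum ≤ n ∧ EvenRun 1 s)]
  · congr 1
    ext s
    constructor
    · rintro ⟨⟨h2, hk, -⟩, hs, hr⟩
      exact ⟨⟨h2, hk, hs⟩, hr⟩
    · rintro ⟨⟨h2, hk, hs⟩, hr⟩
      exact ⟨⟨h2, hk, by omega⟩, hs, hr⟩
  · intro p _
    rw [even_mex_iff, ← count_pos]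
    have := sum_filter_add_numOnes p
    rw [numOnes] at this
    refine and_congr_left fun _ => ?_
    omega

theorem numPartsGT_eq_countP_filter {n m : ℕ} (p : Nat.Partition n) (hm : 1 ≤ m) :
    numPartsGT p m = countP (fun a => m < a) (p.parts.filter (fun a => 1 < a)) := by
  rw [numPartsGT, countP_filter]
  refine countP_congr rfl fun x _ => ?_
  simp only [eq_iff_iff]
  omega

theorem IsDurfeeSplit.countP_le {a m : ℕ} {x : Multiset ℕ × Multiset ℕ} (hx : IsDurfeeSplit a x)
    (hm : card x.1 + a ≤ m) : countP (fun z => m < z) (x.1 + x.2) ≤ card x.1 := by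
  rw [countP_add, (countP_eq_zero (s := x.2)).2 fun z hz => by have := hx.2 z hz; omega]
  exact countP_le_card _ _

theorem IsDurfeeSplit.le_countP {a m : ℕ} {x : Multiset ℕ × Multiset ℕ} (hx : IsDurfeeSplit a x)
    (hm : m < card x.1 + a) : card x.1 ≤ countP (fun z => m < z) (x.1 + x.2) := by
  rw [countP_add, (countP_eq_card (s := x.1)).2 fun z hz => by have := hx.1 z hz; omega]
  omega

theorem crank_neg_iff {n : ℕ} (p : Nat.Partition n) :
    crank p < 0 ↔ 1 ≤ numOnes p ∧ numPartsGT p (numOnes p) < numOnes p := by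
  rw [crank]
  split_ifs with h
  · simp [h]
  · omega

theorem crank_pos_iff {n : ℕ} (p : Nat.Partition n) (h : 0 < numPartsGT p 1) :
    0 < crank p ↔ numOnes p < numPartsGT p (numOnes p) := by
  rw [crank]
  split_ifs with h0
  · rw [h0]
    obtain ⟨x, hx, hx1⟩ := countP_pos.1 h
    refine iff_of_true ?_ (countP_pos.2 ⟨x, hx, by omega⟩)
    have : x ≤ largestPart p := le_sup hx
    omega
  · omega

/-- With `ω ≥ 1` ones, the crank is negative exactly if `ω - 1` is at least the height of the
Durfee rectangle of excess `1` of the parts greater than `1`. -/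
theorem ncard_negCrank (n k : ℕ) : (negCrank (n + 1) k).ncard = (manyOnes 1 n k).ncard := by
  rw [negCrank, ncard_partitions
    (R := fun s => s.sum ≤ n ∧ countP (fun a => n + 1 - s.sum < a) s < n + 1 - s.sum),
    ← ncard_splits_and 1]
  · congr 1
    ext x
    constructor
    · rintro ⟨⟨hd, h2, hk, -⟩, hs, hc⟩
      refine ⟨⟨hd, h2, hk, hs⟩, ?_⟩
      rw [sum_add] at hs hc
      by_contra! hlt
      have := hd.le_countP (m := n + 1 - (x.1.sum + x.2.sum)) (by omega)
      omega
    · rintro ⟨⟨hd, h2, hk, hs⟩, hm⟩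
      refine ⟨⟨hd, h2, hk, by omega⟩, hs, ?_⟩
      rw [sum_add] at hs ⊢
      have := hd.countP_le (m := n + 1 - (x.1.sum + x.2.sum)) (by omega)
      omega
  · intro p _
    have := sum_filter_add_numOnes p
    rw [crank_neg_iff]
    rw [show n + 1 - (p.parts.filter (fun a => 1 < a)).sum = numOnes p by omega]
    constructor
    · rintro ⟨h1, h2⟩
      exact ⟨by omega, by rwa [← numPartsGT_eq_countP_filter p h1]⟩
    · rintro ⟨h1, h2⟩
      have h3 : 1 ≤ numOnes p := by omega
      exact ⟨h3, by rwa [numPartsGT_eq_countP_filter p h3]⟩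

/-- The crank is positive exactly if the number of ones is less than the height of the Durfee
square of the parts greater than `1`. -/
theorem ncard_posCrank (n k : ℕ) (hk : 1 ≤ k) :
    (posCrank n k).ncard + (manyOnes 0 n k).ncard = (bigParts n k).ncard := by
  rw [posCrank, ncard_partitions
    (R := fun s => n - s.sum < countP (fun a => n - s.sum < a) s), ← ncard_splits_and 0,
    ← ncard_splits 0, ← Set.ncard_sdiff_add_ncard_of_subset (t := splits 0 n k)
      (s := manyOnes 0 n k) (fun _ hx => hx.1) (finite_splits 0 n k)]
  · congr 2
    ext x
    constructor
    · rintro ⟨hx, hc⟩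
      refine ⟨hx, fun hm => ?_⟩
      have h1 := hm.2
      rw [sum_add] at hc
      have := hx.1.countP_le (m := n - (x.1.sum + x.2.sum)) (by omega)
      omega
    · rintro ⟨hx, hm⟩
      refine ⟨hx, ?_⟩
      have h1 : ¬ _ := fun h => hm ⟨hx, h⟩
      have h2 := hx.2.2.2
      rw [sum_add] at h2 ⊢
      have := hx.1.le_countP (m := n - (x.1.sum + x.2.sum)) (by omega)
      omega
  · intro p hp
    have := sum_filter_add_numOnes p
    rw [crank_pos_iff p (by omega)]
    rw [show n - (p.parts.filter (fun a => 1 < a)).sum = numOnes p by omega]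
    rcases Nat.eq_zero_or_pos (numOnes p) with h0 | h0
    · rw [h0, numPartsGT, countP_filter]
      have hones : p.parts.count 1 = 0 := h0
      rw [count_eq_zero] at hones
      rw [countP_congr rfl (p' := fun a => 0 < a ∧ 1 < a)]
      intro x hx
      have h1 : x ≠ 1 := fun e => hones (e ▸ hx)
      have := p.parts_pos hx
      simp only [eq_iff_iff]
      omega
    · rw [numPartsGT_eq_countP_filter p h0]

/-- The `i`-th entry (from `0`) of a nonincreasing list is `v` if and only if at most `i` entries
exceed `v` and more than `i` entries are at least `v`. -/
theorem getElem?_eq_some_iff_countP {l : List ℕ} (hl : l.Pairwise (· ≥ ·)) (i v : ℕ) :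
    l[i]? = some v ↔ l.countP (fun a => v < a) ≤ i ∧ i < l.countP (fun a => v ≤ a) := by
  induction l generalizing i with
  | nil => simp
  | cons x l ih =>
    rw [List.pairwise_cons] at hl
    have hgt : x ≤ v → l.countP (fun a => v < a) = 0 := fun h =>
      List.countP_eq_zero.2 fun y hy => by have := hl.1 y hy; simp; omega
    have hge : x < v → l.countP (fun a => v ≤ a) = 0 := fun h =>
      List.countP_eq_zero.2 fun y hy => by have := hl.1 y hy; simp; omega
    simp only [List.countP_cons, decide_eq_true_eq]
    rcases i with _ | i
    · simp only [List.getElem?_cons_zero, Option.some.injEq]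
      rcases lt_trichotomy x v with h | h | h
      · have := hge h
        split_ifs <;> omega
      · have := hgt h.le
        split_ifs <;> omega
      · split_ifs <;> omega
    · rw [List.getElem?_cons_succ, ih hl.2]
      rcases lt_trichotomy x v with h | h | h
      · have := hge h
        split_ifs <;> omega
      · have := hgt h.le
        split_ifs <;> omega
      · split_ifs <;> omega

theorem hasFixedPoint_iff {n : ℕ} (p : Nat.Partition n) :
    HasFixedPoint p ↔ ∃ d, p.parts.countP (fun a => d + 1 < a) ≤ d ∧
      d < p.parts.countP (fun a => d + 1 ≤ a) := by
  refine exists_congr fun d => ?_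
  rw [getElem?_eq_some_iff_countP (by rw [partList]; exact pairwise_sort _ _)]
  conv_rhs => rw [← sort_eq p.parts (· ≥ ·), coe_countP, coe_countP]
  rfl

theorem IsDurfeeSplit.corner_mem_iff {x : Multiset ℕ × Multiset ℕ} (hx : IsDurfeeSplit 0 x) :
    card x.1 + 0 ∈ x.1 ↔ ∃ d, countP (fun a => d + 1 < a) (x.1 + x.2) ≤ d ∧
      d < countP (fun a => d + 1 ≤ a) (x.1 + x.2) := by
  constructor
  · intro h
    have hpos : 0 < card x.1 := card_pos_iff_exists_mem.2 ⟨_, h⟩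
    refine ⟨card x.1 - 1, ?_, ?_⟩
    · have h1 := countP_le_eq_countP_lt_add_count (card x.1) x.1
      have h2 := countP_le_card (fun z => card x.1 ≤ z) x.1
      have h3 : 0 < count (card x.1) x.1 := count_pos.2 h
      have h4 : countP (fun z => card x.1 < z) x.2 = 0 :=
        countP_eq_zero.2 fun z hz => not_lt.2 (hx.2 z hz)
      rw [Nat.sub_add_cancel hpos, countP_add, h4]
      omega
    · have := hx.le_countP (m := card x.1 - 1) (by omega)
      simp only [← Nat.lt_iff_add_one_le]
      omega
  · rintro ⟨d, h1, h2⟩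
    simp only [← Nat.lt_iff_add_one_le] at h2
    have hge : d < card x.1 := by
      by_contra! hle
      have := hx.countP_le (m := d) (by omega)
      omega
    have hle : card x.1 ≤ d + 1 := by
      by_contra! hlt
      have := hx.le_countP (m := d + 1) (by omega)
      omega
    have hd : d + 1 = card x.1 := by omega
    by_contra hc
    have hall : countP (fun z => d + 1 < z) x.1 = card x.1 := countP_eq_card.2 fun z hz => by
      have hne : z ≠ card x.1 + 0 := fun e => hc (e ▸ hz)
      have := hx.1 z hz
      omega
    rw [countP_add, hall] at h1
    omega

theorem ncard_fixedPt (n k : ℕ) (hk : 2 ≤ k) :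
    (fixedPt n k).ncard = (cornerSplits 0 n k).ncard := by
  rw [fixedPt, ncard_partitions
    (R := fun s => ∃ d, countP (fun a => d + 1 < a) s ≤ d ∧ d < countP (fun a => d + 1 ≤ a) s),
    ← ncard_splits_and 0]
  · congr 1
    ext x
    exact and_congr_right fun hx => hx.1.corner_mem_iff.symm
  · intro p hp
    rw [hasFixedPoint_iff]
    refine exists_congr fun d => ?_
    rcases Nat.eq_zero_or_pos d with rfl | hd
    · -- the first of at least two parts greater than one is not `1`
      refine iff_of_false (fun h => ?_) (fun h => ?_)
      · have := h.1
        rw [numPartsGT] at hp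
        simp only [zero_add] at this
        omega
      · have := h.1
        rw [countP_filter] at this
        rw [numPartsGT] at hp
        simp only [zero_add, and_self] at this
        omega
    · rw [countP_filter, countP_filter]
      rw [countP_congr rfl (p' := fun a => d + 1 < a ∧ 1 < a),
        countP_congr (p := fun a => d + 1 ≤ a) rfl (p' := fun a => d + 1 ≤ a ∧ 1 < a)]
      all_goals
        intro x _
        simp only [eq_iff_iff]
        omega

end PartitionStat

theorem theorem1 (n k : ℕ) (hn : 0 < n) (hk : 0 < k) :
    (PartitionStat.evenMex n k).ncard = (PartitionStat.fixedPt n (k + 1)).ncard ∧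
    (PartitionStat.fixedPt n (k + 1)).ncard = (PartitionStat.negCrank n k).ncard ∧
    (PartitionStat.negCrank n k).ncard = (PartitionStat.posCrank n (k + 1)).ncard := by
  obtain ⟨m, rfl⟩ := Nat.exists_eq_succ_of_ne_zero hn.ne'
  have h1 := PartitionStat.ncard_evenMex m k
  have h2 := PartitionStat.ncard_evenRuns m 1 k le_rfl
  have h3 := PartitionStat.ncard_negCrank m k
  have h4 := PartitionStat.ncard_fixedPt (m + 1) (k + 1) (by omega)
  have h5 := PartitionStat.ncard_cornerSplits 0 m k (Or.inr hk)
  have h6 := PartitionStat.ncard_posCrank (m + 1) (k + 1) (by omega)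
  have h7 := PartitionStat.manyOnes_add_cornerSplits 0 (m + 1) (k + 1) (Or.inr (by omega))
  simp only [Nat.succ_eq_add_one, add_zero, zero_add] at *
  refine ⟨?_, ?_, ?_⟩ <;> omega
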